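/- Let $(X,d)$ be a metric space and write $d[X^2]=\{d(x,y):x,y\in X\}$ and $S(c;D)=\{y\in X: d(c,y)\in D\}$ for $c\in X$, $D\subseteq\mathbb R$; write $S(c;r)=S(c;\{r\})$ and $\mathbb Q r=\{qr:q\in\mathbb Q\}$ for $r\in\mathbb R$. Call $X$ a Banakh space if for every $c\in X$ and every $r\in d[X^2]$ there are $u,v\in X$ with $S(c;r)=\{u,v\}$ and $d(u,v)=2r$. Isometries between metric spaces are understood to be surjective. A metric space $Y$ is centrally symmetric if for any distinct $c,y\in Y$ there is an isometry $f:Y\to Y$ with $f(c)=c$ and $f(y)\neq y$. A set $M\subseteq\mathbb R$ is a half-group if $M\cup(-M)$ is a subgroup of $(\mathbb R,+)$. Subsets of $\mathbb R$ and of $X$ carry the induced metric. Theorem. Let $X$ be a Banakh space. (a) For every point $x\in X$ and every $r\in d[X^2]$ the following conditions are equivalent: 1. the metric space $S(x;\mathbb Q r)$ is isometric to a subspace of $\mathbb R$; 2. the metric space $S(x;\mathbb Q r)$ is isometric to a subgroup of the additive group $\mathbb Q r$; 3. $d(y,z)\in\mathbb Q r$ for all $y,z\in S(x;\mathbb Q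 r)$; 4. the metric space $S(x;\mathbb Q r)$ is centrally symmetric; 5. $d[X^2]\cap\mathbb Q r$ is a half-group. (b) If $X$ is nonempty and $d[X^2]\subseteq\mathbb Q$, then $X$ is isometric to a subgroup of $\mathbb Q$. -/

import Mathlib

open scoped Pointwise

namespace BanakhSpace

/-- The distance set `d[X²]` of a metric space. -/
def distSet (X : Type*) [MetricSpace X] : Set ℝ :=
  {r | ∃ x y : X, dist x y = r}

/-- A Banakh space: every sphere `S(c; r)` with `r ∈ d[X²]` has the form `{x, y}`
with `d(x, y) = 2r`. -/
def IsBanakh (X : Type*) [MetricSpace X] : Prop :=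
  ∀ c : X, ∀ r ∈ distSet X, ∃ x y : X, Metric.sphere c r = {x, y} ∧ dist x y = 2 * r

/-- The `D`-sphere `S(x; D) = {y : d(x, y) ∈ D}`, for a set `D` of reals. -/
def setSphere {X : Type*} [MetricSpace X] (x : X) (D : Set ℝ) : Set X :=
  {y | dist x y ∈ D}

/-- The set `ℚr = {qr : q ∈ ℚ}` of real numbers. -/
def ratMultiples (r : ℝ) : Set ℝ :=
  {t | ∃ q : ℚ, t = (q : ℝ) * r}

/-- A metric space is centrally symmetric if for any distinct points `c, x` there is an
isometry of the space onto itself that fixes `c` and moves `x`. -/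
def IsCentrallySymmetric (X : Type*) [MetricSpace X] : Prop :=
  ∀ c x : X, c ≠ x → ∃ f : X ≃ᵢ X, f c = c ∧ f x ≠ x

/-- A set `M` of reals is a half-group if `M ∪ (-M)` is a subgroup of `ℝ`. -/
def IsHalfGroup (M : Set ℝ) : Prop :=
  ∃ H : AddSubgroup ℝ, (H : Set ℝ) = M ∪ (-M)

end BanakhSpace

/-!
Say that `x` separates `y` from `z` if `d(y, z) = d(x, y) + d(x, z)`. Two distinct points at the
same distance from `x` are separated by `x`. Reflecting in successive points prolongs a pair
`x`, `y` to a ray, an isometric copy of `ℕ` scaled by `d(x, y)`; it is enough to control the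
distances between its points number `0` and `2 ^ k`, and these double because a quadrilateral with
sides `r > 0` and diagonals `2r` cannot exist.

Any three points of `S(x; ℚr) \ {x}` lie on rays from `x` that meet a common sphere `S(x; R)`.
This sphere has two points, and `x` separates two of the given points exactly when their rays
end at different ones. Hence "not separated by `x`" is an equivalence relation with at most two
classes, and giving the two classes opposite signs turns `d(x, ·)` into a coordinate on `S(x; ℚr)`.
It is an isometry as soon as all distances in `S(x; ℚr)` lie in `ℚr`.

Let `M = d[X²] ∩ ℚr`, which rays show to be closed under addition. If `S(x; ℚr)` is centrally
symmetric, an isometry fixing `y` and moving `x` reflects `x` in `y`, so `s, t ∈ M` gives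
`|2s - t| ∈ M`. Hence `M ∪ -M` contains with two consecutive terms of an arithmetic progression all
the others, and a suitable progression passes through `s - t` because `s` and `t` are commensurable.
-/

namespace BanakhSpace

section RatMultiples

variable {r a b c : ℝ}

theorem mem_ratMultiples_iff_mem_span : a ∈ ratMultiples r ↔ a ∈ Submodule.span ℚ {r} := by
  simp only [ratMultiples, Set.mem_ofPred_eq, Submodule.mem_span_singleton, Rat.smul_def, eq_comm]

theorem zero_mem_ratMultiples (r : ℝ) : 0 ∈ ratMultiples r :=
  mem_ratMultiples_iff_mem_span.2 (zero_mem _)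

theorem add_mem_ratMultiples (ha : a ∈ ratMultiples r) (hb : b ∈ ratMultiples r) :
    a + b ∈ ratMultiples r := by
  rw [mem_ratMultiples_iff_mem_span] at *
  exact add_mem ha hb

theorem sub_mem_ratMultiples (ha : a ∈ ratMultiples r) (hb : b ∈ ratMultiples r) :
    a - b ∈ ratMultiples r := by
  rw [mem_ratMultiples_iff_mem_span] at *
  exact sub_mem ha hb

theorem abs_mem_ratMultiples_iff : |a| ∈ ratMultiples r ↔ a ∈ ratMultiples r := by
  simp only [mem_ratMultiples_iff_mem_span, abs_mem_iff]

theorem mem_ratMultiples_one : a ∈ ratMultiples 1 ↔ a ∈ Set.range ((↑) : ℚ → ℝ) := by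
  simp only [ratMultiples, mul_one, Set.mem_ofPred_eq, Set.mem_range, eq_comm]

theorem exists_nat_mul_eq_int_mul (ha : a ∈ ratMultiples r) (hb : b ∈ ratMultiples r)
    (hb0 : b ≠ 0) : ∃ m : ℕ, 0 < m ∧ ∃ k : ℤ, m * a = k * b := by
  obtain ⟨p, rfl⟩ := ha
  obtain ⟨q, rfl⟩ := hb
  have hq : q ≠ 0 := by
    rintro rfl
    simp at hb0
  have h : ((p / q).den : ℚ) * p = (p / q).num * q := by
    rw [← Rat.den_mul_eq_num, mul_assoc, div_mul_cancel₀ p hq]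
  refine ⟨(p / q).den, (p / q).den_pos, (p / q).num, ?_⟩
  rw [← mul_assoc, ← mul_assoc]
  exact congrArg (· * r) (by exact_mod_cast h)

theorem exists_nat_mul_eq_nat_mul (ha : a ∈ ratMultiples r) (hb : b ∈ ratMultiples r)
    (ha0 : 0 < a) (hb0 : 0 < b) : ∃ m n : ℕ, 0 < m ∧ 0 < n ∧ (m : ℝ) * a = n * b := by
  obtain ⟨m, hm, k, h⟩ := exists_nat_mul_eq_int_mul ha hb hb0.ne'
  have hk : 0 < k := by
    have : 0 < (k : ℝ) * b := h ▸ by positivity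
    exact_mod_cast pos_of_mul_pos_left this hb0.le
  lift k to ℕ using hk.le
  exact ⟨m, k, hm, by exact_mod_cast hk, by exact_mod_cast h⟩

theorem exists_common_nat_mul (ha : a ∈ ratMultiples r) (hb : b ∈ ratMultiples r)
    (hc : c ∈ ratMultiples r) (ha0 : 0 < a) (hb0 : 0 < b) (hc0 : 0 < c) :
    ∃ k m n : ℕ, 0 < k ∧ 0 < m ∧ 0 < n ∧ (k : ℝ) * a = m * b ∧ (m : ℝ) * b = n * c := by
  obtain ⟨k₁, m₁, hk₁, hm₁, hab⟩ := exists_nat_mul_eq_nat_mul ha hb ha0 hb0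
  obtain ⟨m₂, n₂, hm₂, hn₂, hbc⟩ := exists_nat_mul_eq_nat_mul hb hc hb0 hc0
  refine ⟨k₁ * m₂, m₁ * m₂, m₁ * n₂, by positivity, by positivity, by positivity, ?_, ?_⟩ <;>
    push_cast
  · linear_combination (m₂ : ℝ) * hab
  · linear_combination (m₁ : ℝ) * hbc

end RatMultiples

section Abs

variable {a b : ℝ}

theorem abs_sub_of_mul_nonpos (h : a * b ≤ 0) : |a - b| = |a| + |b| := by
  rcases mul_nonpos_iff.1 h with ⟨ha, hb⟩ | ⟨ha, hb⟩
  · rw [abs_of_nonneg ha, abs_of_nonpos hb, abs_of_nonneg (by linarith), sub_eq_add_neg]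
  · rw [abs_of_nonpos ha, abs_of_nonneg hb, abs_of_nonpos (by linarith), neg_sub', sub_neg_eq_add]

theorem abs_sub_of_mul_nonneg (h : 0 ≤ a * b) : |a - b| = |(|a| - |b|)| := by
  rcases mul_nonneg_iff.1 h with ⟨ha, hb⟩ | ⟨ha, hb⟩
  · rw [abs_of_nonneg ha, abs_of_nonneg hb]
  · rw [abs_of_nonpos ha, abs_of_nonpos hb, neg_sub_neg, abs_sub_comm]

end Abs

section HalfGroup

variable {M : Set ℝ}

theorem mem_union_neg_iff_abs_mem (hM : ∀ t ∈ M, 0 ≤ t) {t : ℝ} : t ∈ M ∪ -M ↔ |t| ∈ M := by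
  constructor
  · rintro (ht | ht)
    · rwa [abs_of_nonneg (hM t ht)]
    · rwa [← abs_neg, abs_of_nonneg (hM _ ht)]
  · rcases abs_choice t with h | h <;> rw [h]
    exacts [Or.inl, Or.inr]

theorem isHalfGroup_of_abs_sub_mem (hM : ∀ t ∈ M, 0 ≤ t) (h0 : 0 ∈ M)
    (hsub : ∀ a b : ℝ, |a| ∈ M → |b| ∈ M → |a - b| ∈ M) : IsHalfGroup M := by
  refine ⟨AddSubgroup.ofSub (M ∪ -M) ⟨0, Or.inl h0⟩ fun a ha b hb => ?_, rfl⟩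
  rw [mem_union_neg_iff_abs_mem hM] at *
  rw [← sub_eq_add_neg]
  exact hsub a b ha hb

theorem IsHalfGroup.abs_sub_mem (h : IsHalfGroup M) (hM : ∀ t ∈ M, 0 ≤ t) {s t : ℝ} (hs : s ∈ M)
    (ht : t ∈ M) : |s - t| ∈ M := by
  obtain ⟨H, hH⟩ := h
  have hle : M ⊆ H := hH ▸ Set.subset_union_left
  rw [← mem_union_neg_iff_abs_mem hM, ← hH]
  exact H.sub_mem (hle hs) (hle ht)

theorem add_nsmul_mem_of_two_nsmul_sub_mem {G : Type*} [AddCommGroup G] {N : Set G}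
    (hN : ∀ a ∈ N, ∀ b ∈ N, 2 • a - b ∈ N) {a d : G} (ha : a ∈ N) (had : a + d ∈ N) (n : ℕ) :
    a + n • d ∈ N := by
  suffices a + n • d ∈ N ∧ a + (n + 1) • d ∈ N from this.1
  induction n with
  | zero => simpa using ⟨ha, had⟩
  | succ n ih =>
    refine ⟨ih.2, ?_⟩
    convert hN _ ih.2 _ ih.1 using 1
    simp only [add_nsmul, one_nsmul, two_nsmul]
    abel

theorem add_zsmul_mem_of_two_nsmul_sub_mem {G : Type*} [AddCommGroup G] {N : Set G}
    (hN : ∀ a ∈ N, ∀ b ∈ N, 2 • a - b ∈ N) {a d : G} (ha : a ∈ N) (had : a + d ∈ N) (k : ℤ) :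
    a + k • d ∈ N := by
  rcases k.eq_nat_or_neg with ⟨n, rfl | rfl⟩
  · simpa using add_nsmul_mem_of_two_nsmul_sub_mem hN ha had n
  · have had' : a + -d ∈ N := by
      convert hN a ha (a + d) had using 1
      rw [two_nsmul]
      abel
    simpa using add_nsmul_mem_of_two_nsmul_sub_mem hN ha had' n

theorem abs_sub_mem_of_abs_mem (hadd : ∀ s ∈ M, ∀ t ∈ M, s + t ∈ M) {a b : ℝ} (ha : |a| ∈ M)
    (hb : |b| ∈ M) (hab : |(|a| - |b|)| ∈ M) : |a - b| ∈ M := by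
  rcases le_total (a * b) 0 with h | h
  · rw [abs_sub_of_mul_nonpos h]
    exact hadd _ ha _ hb
  · rwa [abs_sub_of_mul_nonneg h]

theorem abs_two_nsmul_sub_mem_of_abs_mem (hadd : ∀ s ∈ M, ∀ t ∈ M, s + t ∈ M)
    (hrefl : ∀ s ∈ M, ∀ t ∈ M, |2 * s - t| ∈ M) {a b : ℝ} (ha : |a| ∈ M) (hb : |b| ∈ M) :
    |2 • a - b| ∈ M := by
  have h2 : |2 • a| = 2 * |a| := by rw [nsmul_eq_mul, Nat.cast_two, abs_mul, abs_two]
  have ha2 : |2 • a| ∈ M := by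
    rw [h2, two_mul]
    exact hadd _ ha _ ha
  exact abs_sub_mem_of_abs_mem hadd ha2 hb (h2 ▸ hrefl _ ha _ hb)

theorem abs_sub_mem_of_abs_two_mul_sub_mem {r : ℝ} (hM : ∀ t ∈ M, 0 ≤ t)
    (hMr : M ⊆ ratMultiples r) (h0 : 0 ∈ M) (hadd : ∀ s ∈ M, ∀ t ∈ M, s + t ∈ M)
    (hrefl : ∀ s ∈ M, ∀ t ∈ M, |2 * s - t| ∈ M) {s t : ℝ} (hs : s ∈ M) (ht : t ∈ M) :
    |s - t| ∈ M := by
  have hN : ∀ a ∈ {a : ℝ | |a| ∈ M}, ∀ b ∈ {b : ℝ | |b| ∈ M}, 2 • a - b ∈ {c : ℝ | |c| ∈ M} :=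
    fun _ ha _ hb => abs_two_nsmul_sub_mem_of_abs_mem hadd hrefl ha hb
  have hmul : ∀ n : ℕ, n * t ∈ M := by
    intro n
    induction n with
    | zero => simpa using h0
    | succ n ih =>
      rw [Nat.cast_succ, add_one_mul]
      exact hadd _ ih _ ht
  rcases eq_or_ne (s - t) 0 with hst | hst
  · rwa [hst, abs_zero]
  obtain ⟨m, hm, k, hmk⟩ :=
    exists_nat_mul_eq_int_mul (hMr ht) (sub_mem_ratMultiples (hMr hs) (hMr ht)) hst
  obtain ⟨n, rfl⟩ := Nat.exists_eq_add_one.2 hm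
  have ha : |(n + 1 : ℕ) * t| ∈ M := by
    rw [abs_of_nonneg (hM _ (hmul _))]
    exact hmul _
  have had : |(n + 1 : ℕ) * t + (s - t)| ∈ M := by
    have h : (n + 1 : ℕ) * t + (s - t) = n * t + s := by
      push_cast
      ring
    have hmem := hadd _ (hmul n) _ hs
    rwa [h, abs_of_nonneg (hM _ hmem)]
  -- As `(n + 1) * t = k * (s - t)`, the progression from `(n + 1) * t` with difference `s - t`
  -- passes through `s - t`.
  have h : (n + 1 : ℕ) * t + (1 - k) • (s - t) = s - t := by
    rw [hmk, zsmul_eq_mul]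
    push_cast
    ring
  exact h ▸ add_zsmul_mem_of_two_nsmul_sub_mem hN ha had (1 - k)

theorem isHalfGroup_of_abs_two_mul_sub_mem {r : ℝ} (hM : ∀ t ∈ M, 0 ≤ t) (hMr : M ⊆ ratMultiples r)
    (h0 : 0 ∈ M) (hadd : ∀ s ∈ M, ∀ t ∈ M, s + t ∈ M)
    (hrefl : ∀ s ∈ M, ∀ t ∈ M, |2 * s - t| ∈ M) : IsHalfGroup M :=
  isHalfGroup_of_abs_sub_mem hM h0 fun _ _ ha hb => abs_sub_mem_of_abs_mem hadd ha hb
    (abs_sub_mem_of_abs_two_mul_sub_mem hM hMr h0 hadd hrefl ha hb)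

end HalfGroup

section Separates

variable {X : Type*} [MetricSpace X] {x y z : X}

/-- The point `x` lies metrically between `y` and `z`. When `x` is held fixed, `¬ Separates x y z`
says that `y` and `z` are on the same side of `x`. -/
def Separates (x y z : X) : Prop :=
  dist y z = dist x y + dist x z

theorem Separates.symm (h : Separates x y z) : Separates x z y := by
  rw [Separates, dist_comm, h, add_comm]

theorem separates_self_left (x z : X) : Separates x x z := by
  simp [Separates]

theorem separates_self_right (x y : X) : Separates x y x := by
  simp [Separates, dist_comm]

theorem Separates.not_separates (h : Separates y x z) (hyx : y ≠ x) : ¬ Separates x y z := by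
  intro h'
  have := dist_pos.2 hyx
  simp only [Separates, dist_comm x y] at h h'
  linarith

theorem dist_mem_distSet (x y : X) : dist x y ∈ distSet X := ⟨x, y, rfl⟩

theorem zero_mem_distSet (x : X) : 0 ∈ distSet X := ⟨x, x, dist_self x⟩

theorem self_mem_setSphere (x : X) (r : ℝ) : x ∈ setSphere x (ratMultiples r) := by
  simpa only [setSphere, Set.mem_ofPred_eq, dist_self] using zero_mem_ratMultiples r

theorem distSet_nonneg {t : ℝ} (ht : t ∈ distSet X) : 0 ≤ t := by
  obtain ⟨x, y, rfl⟩ := ht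
  exact dist_nonneg

open Classical in
/-- The distance from `x`, with a minus sign at the points that `x` separates from the reference
point `e`. -/
noncomputable def signedDist (x e y : X) : ℝ :=
  if Separates x y e then -dist x y else dist x y

theorem abs_signedDist (x e y : X) : |signedDist x e y| = dist x y := by
  unfold signedDist
  split_ifs <;> simp

end Separates

namespace IsBanakh

variable {X : Type*} [MetricSpace X]

section Spheres

variable {x y z w : X}

theorem exists_dist_eq (hX : IsBanakh X) (x : X) {t : ℝ} (ht : t ∈ distSet X) :
    ∃ u v : X, dist x u = t ∧ dist x v = t ∧ dist u v = 2 * t := by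
  obtain ⟨u, v, huv, h⟩ := hX x t ht
  have hu : u ∈ Metric.sphere x t := by simp [huv]
  have hv : v ∈ Metric.sphere x t := by simp [huv]
  exact ⟨u, v, Metric.mem_sphere'.1 hu, Metric.mem_sphere'.1 hv, h⟩

theorem dist_eq_two_mul (hX : IsBanakh X) (h : dist x y = dist x z) (hyz : y ≠ z) :
    dist y z = 2 * dist x y := by
  obtain ⟨u, v, huv, hd⟩ := hX x _ (dist_mem_distSet x y)
  have hy : y ∈ Metric.sphere x (dist x y) := Metric.mem_sphere'.2 rfl
  have hz : z ∈ Metric.sphere x (dist x y) := Metric.mem_sphere'.2 h.symm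
  rw [huv] at hy hz
  rcases hy with rfl | rfl <;> rcases hz with rfl | rfl
  · exact absurd rfl hyz
  · exact hd
  · rwa [dist_comm]
  · exact absurd rfl hyz

theorem separates_of_dist_eq (hX : IsBanakh X) (h : dist x y = dist x z) (hyz : y ≠ z) :
    Separates x y z := by
  rw [Separates, hX.dist_eq_two_mul h hyz, two_mul, ← h]

theorem eq_of_not_separates (hX : IsBanakh X) (h : dist x y = dist x z)
    (hyz : ¬ Separates x y z) : y = z :=
  not_imp_comm.1 (hX.separates_of_dist_eq h) hyz

theorem eq_of_separates_of_separates (hX : IsBanakh X) (hyx : y ≠ x) (hz : Separates x y z)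
    (hw : Separates x y w) (h : dist x z = dist x w) : z = w := by
  by_contra hzw
  have hx := hX.dist_eq_two_mul h hzw
  have hy := hX.dist_eq_two_mul (hz.trans (h ▸ Eq.symm hw)) hzw
  have := dist_pos.2 hyx.symm
  rw [hz] at hy
  linarith

theorem exists_reflection (hX : IsBanakh X) (x y : X) :
    ∃ z, dist x z = dist x y ∧ dist y z = 2 * dist x y := by
  obtain ⟨u, v, hu, hv, huv⟩ := hX.exists_dist_eq x (dist_mem_distSet x y)
  by_cases hyu : y = u
  · exact ⟨v, hv, hyu ▸ huv⟩
  · exact ⟨u, hu, hX.dist_eq_two_mul hu.symm hyu⟩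

theorem exists_not_separates (hX : IsBanakh X) (hyx : y ≠ x) {t : ℝ} (ht : t ∈ distSet X)
    (ht0 : t ≠ 0) : ∃ z, dist x z = t ∧ ¬ Separates x y z := by
  obtain ⟨u, v, hu, hv, huv⟩ := hX.exists_dist_eq x ht
  by_contra! h
  have : u = v := hX.eq_of_separates_of_separates hyx (h u hu) (h v hv) (hu.trans hv.symm)
  simp [this, ht0] at huv

end Spheres

end IsBanakh

section Rays

variable {X : Type*} [MetricSpace X] {c : ℕ → X} {r : ℝ}

/-- Any three consecutive points of the sequence are isometric to `0, r, 2r`. In a Banakh space this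
local condition implies the global one, see `IsLocalRay.dist_add`. -/
structure IsLocalRay (c : ℕ → X) (r : ℝ) : Prop where
  dist_one : ∀ n, dist (c n) (c (n + 1)) = r
  dist_two : ∀ n, dist (c n) (c (n + 2)) = 2 * r

theorem IsBanakh.exists_isLocalRay (hX : IsBanakh X) (x y : X) :
    ∃ c : ℕ → X, c 0 = x ∧ c 1 = y ∧ IsLocalRay c (dist x y) := by
  choose f hf₁ hf₂ using hX.exists_reflection
  let T : X × X → X × X := fun p => (p.2, f p.2 p.1)
  let c : ℕ → X := fun n => (T^[n] (x, y)).1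
  have hc : ∀ n, c (n + 2) = f (c (n + 1)) (c n) := fun n => by
    simp only [c, T, Function.iterate_succ_apply']
  have hstep : ∀ n, dist (c n) (c (n + 1)) = dist x y := by
    intro n
    induction n with
    | zero => rfl
    | succ n ih => rw [hc, hf₁, dist_comm, ih]
  exact ⟨c, rfl, rfl, hstep, fun n => by rw [hc, hf₂, dist_comm, hstep]⟩

namespace IsLocalRay

theorem dist_four (hc : IsLocalRay c r) (hX : IsBanakh X) (n : ℕ) :
    dist (c n) (c (n + 4)) = 4 * r := by
  have h01 := hc.dist_one n
  have h12 := hc.dist_one (n + 1)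
  have h23 := hc.dist_one (n + 2)
  have h34 := hc.dist_one (n + 3)
  have h02 := hc.dist_two n
  have h13 := hc.dist_two (n + 1)
  have h24 := hc.dist_two (n + 2)
  by_cases h : c n = c (n + 4)
  · -- The reflection `z` of `c n` in `c (n + 2)` is at distance `3r` from both `c (n + 1)` and
    -- `c (n + 3)`, which are only `2r` apart.
    obtain ⟨z, hz, hz'⟩ := hX.exists_reflection (c (n + 2)) (c n)
    rw [← h, dist_comm] at h34
    rw [dist_comm _ (c n), h02] at hz hz'
    have hz1 : dist z (c (n + 1)) = 3 * r := by
      linarith [dist_triangle_left z (c (n + 1)) (c (n + 2)), dist_comm (c (n + 1)) (c (n + 2)),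
        dist_triangle_right (c n) z (c (n + 1))]
    have hz3 : dist z (c (n + 3)) = 3 * r := by
      linarith [dist_triangle_left z (c (n + 3)) (c (n + 2)),
        dist_triangle_right (c n) z (c (n + 3))]
    have hr : r = 0 := by
      by_contra hr
      have hne : c (n + 1) ≠ c (n + 3) := fun he => hr (by simpa [he] using h13)
      have h6 := hX.dist_eq_two_mul (hz1.trans hz3.symm) hne
      exact hr (by linarith)
    rw [← h, dist_self, hr, mul_zero]
  · rw [hX.dist_eq_two_mul (x := c (n + 2)) (by rw [dist_comm, h02, h24]) h, dist_comm, h02]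
    ring

theorem double (hc : IsLocalRay c r) (hX : IsBanakh X) :
    IsLocalRay (fun n => c (2 * n)) (2 * r) where
  dist_one n := hc.dist_two (2 * n)
  dist_two n := by
    rw [mul_add, hc.dist_four hX]
    ring

theorem dist_two_pow (hc : IsLocalRay c r) (hX : IsBanakh X) (k : ℕ) :
    dist (c 0) (c (2 ^ k)) = 2 ^ k * r := by
  induction k generalizing c r with
  | zero => simpa using hc.dist_one 0
  | succ k ih => simpa only [mul_zero, pow_succ', mul_assoc, mul_left_comm] using ih (hc.double hX)

theorem dist_add_le (hc : IsLocalRay c r) (m n : ℕ) : dist (c m) (c (m + n)) ≤ n * r := by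
  simpa [hc.dist_one] using dist_le_Ico_sum_dist c (Nat.le_add_right m n)

theorem dist_zero (hc : IsLocalRay c r) (hX : IsBanakh X) (n : ℕ) :
    dist (c 0) (c n) = n * r := by
  apply le_antisymm
  · simpa using hc.dist_add_le 0 n
  · obtain ⟨k, hk⟩ := Nat.exists_eq_add_of_le (Nat.lt_two_pow_self (n := n)).le
    have hpow := hc.dist_two_pow hX n
    have htail := hc.dist_add_le n k
    have htri := dist_triangle (c 0) (c n) (c (2 ^ n))
    have hcast : (2 : ℝ) ^ n = n + k := by exact_mod_cast hk
    rw [← hk] at htail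
    rw [hpow, hcast] at htri
    linarith

theorem dist_add (hc : IsLocalRay c r) (hX : IsBanakh X) (m n : ℕ) :
    dist (c m) (c (m + n)) = n * r :=
  dist_zero (c := fun k => c (m + k)) ⟨fun k => hc.dist_one (m + k), fun k => hc.dist_two (m + k)⟩
    hX n

theorem separates (hc : IsLocalRay c r) (hX : IsBanakh X) (l m n : ℕ) :
    Separates (c (l + m)) (c l) (c (l + m + n)) := by
  rw [Separates, dist_comm _ (c l), add_assoc, hc.dist_add hX, hc.dist_add hX, ← add_assoc,
    hc.dist_add hX, Nat.cast_add, add_mul]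

end IsLocalRay

end Rays

namespace IsBanakh

variable {X : Type*} [MetricSpace X] {x y z w e : X} {r s t : ℝ}

section Sides

theorem exists_separates_dist_eq_mul (hX : IsBanakh X) (x y : X) {n : ℕ} (hn : 0 < n) :
    ∃ p, Separates y x p ∧ dist x p = n * dist x y := by
  obtain ⟨c, rfl, rfl, hc⟩ := hX.exists_isLocalRay x y
  obtain ⟨k, rfl⟩ := Nat.exists_eq_add_of_le hn
  exact ⟨c (1 + k), by simpa using hc.separates hX 0 1 k, hc.dist_zero hX _⟩

theorem separates_of_ne {p q : X} (hX : IsBanakh X) (hp : Separates y x p) (hq : Separates z x q)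
    (h : dist x p = dist x q) (hpq : p ≠ q) : Separates x y z := by
  have hpq := hX.dist_eq_two_mul h hpq
  have hle := dist_triangle4 p y z q
  have hge := dist_triangle_left y z x
  simp only [Separates] at *
  rw [dist_comm p y] at hle
  rw [dist_comm y x] at hp
  rw [dist_comm z x] at hq
  linarith

theorem ne_of_separates {p q : X} (hX : IsBanakh X) (hyx : y ≠ x) (hzx : z ≠ x)
    (hyz : Separates x y z) (hp : Separates y x p) (hq : Separates z x q) {n : ℕ} (hn : 0 < n)
    (hxp : dist x p = n * dist x z) (hxq : dist x q = n * dist x z) : p ≠ q := by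
  rintro rfl
  obtain ⟨c, rfl, rfl, hc⟩ := hX.exists_isLocalRay z x
  obtain ⟨k, rfl⟩ := Nat.exists_eq_add_of_le hn
  have hz := dist_pos.2 hzx
  have hz' : Separates (c 2) (c 1) (c (2 + k)) := hc.separates hX 1 1 k
  have hxq' : dist (c 1) (c (2 + k)) = (1 + k : ℕ) * dist (c 0) (c 1) := by
    rw [← hc.dist_add hX 1 (1 + k), ← add_assoc]
  have hne : p ≠ c (2 + k) := by
    rintro rfl
    have := hc.dist_zero hX (2 + k)
    rw [Separates, hxq', this] at hq
    push_cast at hq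
    linarith
  have hyz' : Separates (c 1) y (c 2) :=
    hX.separates_of_ne hp hz' (by rw [hxp, hxq', dist_comm (c 1) (c 0)]) hne
  have h02 : c 0 = c 2 :=
    hX.eq_of_separates_of_separates hyx hyz hyz' (by rw [dist_comm]; exact (hc.dist_one 1).symm)
  have := hc.dist_two 0
  rw [← h02, dist_self] at this
  linarith

theorem separates_or_separates (hX : IsBanakh X) (hy : dist x y ∈ ratMultiples r)
    (hz : dist x z ∈ ratMultiples r) (hw : dist x w ∈ ratMultiples r) (h : Separates x y w) :
    Separates x y z ∨ Separates x z w := by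
  rcases eq_or_ne y x with rfl | hyx
  · exact .inl (separates_self_left _ _)
  rcases eq_or_ne z x with rfl | hzx
  · exact .inl (separates_self_right _ _)
  rcases eq_or_ne w x with rfl | hwx
  · exact .inr (separates_self_right _ _)
  obtain ⟨k, m, n, hk, hm, hn, hyz, hzw⟩ := exists_common_nat_mul hy hz hw
    (dist_pos.2 hyx.symm) (dist_pos.2 hzx.symm) (dist_pos.2 hwx.symm)
  obtain ⟨p, hp, hxp⟩ := hX.exists_separates_dist_eq_mul x y hk
  obtain ⟨q, hq, hxq⟩ := hX.exists_separates_dist_eq_mul x z hm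
  obtain ⟨s, hs, hxs⟩ := hX.exists_separates_dist_eq_mul x w hn
  have hps : p ≠ s :=
    hX.ne_of_separates hyx hwx h hp hs hn (hxp.trans (hyz.trans hzw)) hxs
  by_cases hpq : p = q
  · exact .inr (hX.separates_of_ne hq hs (by rw [hxq, hxs, hzw]) (hpq ▸ hps))
  · exact .inl (hX.separates_of_ne hp hq (by rw [hxp, hxq, hyz]) hpq)

theorem not_separates_trans (hX : IsBanakh X) (hy : dist x y ∈ ratMultiples r)
    (hz : dist x z ∈ ratMultiples r) (hw : dist x w ∈ ratMultiples r) (hyz : ¬ Separates x y z)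
    (hzw : ¬ Separates x z w) : ¬ Separates x y w :=
  fun h => (hX.separates_or_separates hy hz hw h).elim hyz hzw

theorem not_separates_of_separates_of_separates (hX : IsBanakh X)
    (hy : dist x y ∈ ratMultiples r) (hz : dist x z ∈ ratMultiples r)
    (hw : dist x w ∈ ratMultiples r) (hyx : y ≠ x) (hzx : z ≠ x) (hwx : w ≠ x)
    (hyw : Separates x y w) (hzw : Separates x z w) : ¬ Separates x y z := by
  obtain ⟨w', hxw', hww'⟩ := hX.exists_reflection x w
  have hsame : ∀ v, v ≠ x → Separates x v w → ¬ Separates x v w' := by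
    intro v hvx hv hv'
    have : w = w' := hX.eq_of_separates_of_separates hvx hv hv' hxw'.symm
    simp [← this, hwx.symm] at hww'
  exact hX.not_separates_trans hy (hxw' ▸ hw) hz (hsame y hyx hyw)
    fun h => hsame z hzx hzw h.symm

theorem exists_separates_dist_eq (hX : IsBanakh X) (hy : dist x y ∈ ratMultiples r)
    (ht : t ∈ distSet X ∩ ratMultiples r) : ∃ p, Separates x y p ∧ dist x p = t := by
  obtain ⟨u, v, hu, hv, huv⟩ := hX.exists_dist_eq x ht.1
  have hsep : Separates x u v := by rw [Separates, huv, hu, hv, two_mul]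
  rcases hX.separates_or_separates (hu ▸ ht.2) hy (hv ▸ ht.2) hsep with h | h
  · exact ⟨u, h.symm, hu⟩
  · exact ⟨v, h, hv⟩

theorem add_mem_distSet (hX : IsBanakh X) (hs : s ∈ distSet X ∩ ratMultiples r)
    (ht : t ∈ distSet X ∩ ratMultiples r) : s + t ∈ distSet X ∩ ratMultiples r := by
  refine ⟨?_, add_mem_ratMultiples hs.2 ht.2⟩
  obtain ⟨x, y, rfl⟩ := hs.1
  obtain ⟨p, hp, rfl⟩ := hX.exists_separates_dist_eq hs.2 ht
  exact ⟨y, p, hp⟩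

theorem dist_eq_abs_sub_of_not_separates (hX : IsBanakh X) (hy : dist x y ∈ ratMultiples r)
    (hz : dist x z ∈ ratMultiples r) (hyz : dist y z ∈ ratMultiples r) (h : ¬ Separates x y z) :
    dist y z = |dist x y - dist x z| := by
  have hyx : y ≠ x := fun he => h (he ▸ separates_self_left y z)
  have hzx : z ≠ x := fun he => h (he ▸ separates_self_right z y)
  -- Prolonging `xy` by `d(x, z)` and `xz` by `d(x, y)` leads to the same point `p`.
  obtain ⟨p, hp, hyp⟩ := hX.exists_separates_dist_eq (x := y) (y := x) (dist_comm x y ▸ hy)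
    ⟨dist_mem_distSet x z, hz⟩
  obtain ⟨q, hq, hzq⟩ := hX.exists_separates_dist_eq (x := z) (y := x) (dist_comm x z ▸ hz)
    ⟨dist_mem_distSet x y, hy⟩
  have hxp : dist x p = dist x y + dist x z := by rw [hp, hyp, dist_comm]
  have hxq : dist x q = dist x y + dist x z := by rw [hq, hzq, dist_comm, add_comm]
  have hR := add_mem_ratMultiples hy hz
  have hpz : ¬ Separates x p z :=
    hX.not_separates_trans (hxp ▸ hR) hy hz (fun hs => hp.not_separates hyx hs.symm) h
  have hpq : p = q := hX.eq_of_not_separates (hxp.trans hxq.symm)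
    (hX.not_separates_trans (hxp ▸ hR) hz (hxq ▸ hR) hpz (hq.not_separates hzx))
  subst hpq
  have hle := le_abs_self (dist x y - dist x z)
  have hle' := neg_abs_le (dist x y - dist x z)
  have hge : |dist x y - dist x z| ≤ dist y z := by
    simpa only [dist_comm x] using abs_dist_sub_le y z x
  rcases hX.separates_or_separates (x := z) (z := y) (dist_comm x z ▸ hz) (dist_comm y z ▸ hyz)
    (hzq ▸ hy) hq with hs | hs <;> rw [Separates] at hs
  · linarith [dist_comm z x, dist_comm z y]
  · linarith [dist_comm z y]

theorem dist_eq_abs_sub_of_abs_sub_mem (hX : IsBanakh X) (hy : dist x y ∈ ratMultiples r)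
    (hz : dist x z ∈ ratMultiples r) (hyz : |dist x y - dist x z| ∈ distSet X)
    (h : ¬ Separates x y z) : dist y z = |dist x y - dist x z| := by
  wlog hle : dist x z ≤ dist x y generalizing y z
  · rw [dist_comm, abs_sub_comm]
    rw [abs_sub_comm] at hyz
    exact this hz hy hyz (fun hs => h hs.symm) (le_of_not_ge hle)
  have hzx : z ≠ x := fun he => h (he ▸ separates_self_right z y)
  rw [abs_of_nonneg (sub_nonneg.2 hle)] at hyz ⊢
  obtain ⟨p, hp, hzp⟩ := hX.exists_separates_dist_eq (x := z) (y := x) (dist_comm x z ▸ hz)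
    ⟨hyz, sub_mem_ratMultiples hy hz⟩
  have hxp : dist x p = dist x y := by rw [hp, hzp, dist_comm, add_sub_cancel]
  have hyp : y = p := hX.eq_of_not_separates hxp.symm
    (hX.not_separates_trans hy hz (hxp ▸ hy) h (hp.not_separates hzx))
  rw [hyp, dist_comm, hzp, hxp]

end Sides

section SignedDist

theorem signedDist_mul_nonpos_iff (hX : IsBanakh X) (he : dist x e ∈ ratMultiples r)
    (hy : dist x y ∈ ratMultiples r) (hz : dist x z ∈ ratMultiples r) (hex : y ≠ x → e ≠ x) :
    signedDist x e y * signedDist x e z ≤ 0 ↔ Separates x y z := by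
  rcases eq_or_ne y x with rfl | hyx
  · simp [signedDist, separates_self_left]
  rcases eq_or_ne z x with rfl | hzx
  · simp [signedDist, separates_self_right]
  have hpos : 0 < dist x y * dist x z := mul_pos (dist_pos.2 hyx.symm) (dist_pos.2 hzx.symm)
  unfold signedDist
  split_ifs with hye hze hze
  · have := hX.not_separates_of_separates_of_separates hy hz he hyx hzx (hex hyx) hye hze
    simp [this, hpos]
  · have : Separates x y z := (hX.separates_or_separates hy hz he hye).resolve_right hze
    simp [this, hpos.le]
  · have : Separates x z y := (hX.separates_or_separates hz hy he hze).resolve_right hye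
    simp [this.symm, hpos.le]
  · have := hX.not_separates_trans hy he hz hye (fun h => hze h.symm)
    simp [this, hpos]

theorem dist_eq_abs_signedDist_sub (hX : IsBanakh X) (he : dist x e ∈ ratMultiples r)
    (hy : dist x y ∈ ratMultiples r) (hz : dist x z ∈ ratMultiples r)
    (hyz : dist y z ∈ ratMultiples r) (hex : y ≠ x → e ≠ x) :
    dist y z = |signedDist x e y - signedDist x e z| := by
  have hiff := hX.signedDist_mul_nonpos_iff he hy hz hex
  by_cases h : Separates x y z
  · rw [abs_sub_of_mul_nonpos (hiff.2 h), abs_signedDist, abs_signedDist]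
    exact h
  · rw [abs_sub_of_mul_nonneg (not_le.1 (mt hiff.1 h)).le, abs_signedDist, abs_signedDist]
    exact hX.dist_eq_abs_sub_of_not_separates hy hz hyz h

theorem exists_signedDist_eq (hX : IsBanakh X) (he : dist x e ∈ ratMultiples r)
    (ht : |t| ∈ distSet X ∩ ratMultiples r) (hex : ∀ y, dist x y ∈ ratMultiples r → y ≠ x → e ≠ x) :
    ∃ y, dist x y = |t| ∧ signedDist x e y = t := by
  obtain ⟨u, v, hu, hv, huv⟩ := hX.exists_dist_eq x ht.1
  have hsep : Separates x u v := by rw [Separates, huv, hu, hv, two_mul]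
  have hle := (hX.signedDist_mul_nonpos_iff he (hu ▸ ht.2) (hv ▸ ht.2)
    (hex u (hu ▸ ht.2))).2 hsep
  rcases abs_eq_abs.1 ((abs_signedDist x e u).trans hu) with h | h
  · exact ⟨u, hu, h⟩
  rcases abs_eq_abs.1 ((abs_signedDist x e v).trans hv) with h' | h'
  · exact ⟨v, hv, h'⟩
  have ht0 : t = 0 := by
    rw [h, h'] at hle
    nlinarith
  exact ⟨u, hu, by rw [h, ht0, neg_zero]⟩

end SignedDist

end IsBanakh

section Isometry

theorem nonempty_isometryEquiv_of_range_eq {Y Z : Type*} [MetricSpace Y] [MetricSpace Z] {f : Y → Z}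
    {s : Set Z} (hf : Isometry f) (hs : Set.range f = s) : Nonempty (Y ≃ᵢ s) :=
  hs ▸ ⟨hf.isometryEquivOnRange⟩

theorem isCentrallySymmetric_of_isometryEquiv {Y G : Type*} [MetricSpace Y]
    [NormedAddCommGroup G] [IsAddTorsionFree G] (g : Y ≃ᵢ G) : IsCentrallySymmetric Y := by
  intro c y hcy
  refine ⟨(g.trans (IsometryEquiv.subLeft (2 • g c))).trans g.symm, ?_, ?_⟩
  · simp [two_nsmul]
  · simp only [IsometryEquiv.trans_apply, IsometryEquiv.subLeft_apply, ne_eq,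
      IsometryEquiv.symm_apply_eq, sub_eq_iff_eq_add, ← two_nsmul]
    exact fun h => hcy (g.injective (nsmul_right_injective two_ne_zero h))

theorem dist_mem_ratMultiples_of_isometry {Y : Type*} [MetricSpace Y] {f : Y → ℝ} (hf : Isometry f)
    {r : ℝ} {c y z : Y} (hy : dist c y ∈ ratMultiples r) (hz : dist c z ∈ ratMultiples r) :
    dist y z ∈ ratMultiples r := by
  rw [← hf.dist_eq, Real.dist_eq, abs_mem_ratMultiples_iff] at *
  simpa using sub_mem_ratMultiples hz hy

end Isometry

namespace IsBanakh

variable {X : Type*} [MetricSpace X]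

theorem dist_mem_ratMultiples_of_isHalfGroup {x y z : X} {r : ℝ} (hX : IsBanakh X)
    (h : IsHalfGroup (distSet X ∩ ratMultiples r)) (hy : dist x y ∈ ratMultiples r)
    (hz : dist x z ∈ ratMultiples r) : dist y z ∈ ratMultiples r := by
  by_cases hs : Separates x y z
  · rw [hs]
    exact add_mem_ratMultiples hy hz
  · have hsub := h.abs_sub_mem (fun t ht => distSet_nonneg ht.1) ⟨dist_mem_distSet x y, hy⟩
      ⟨dist_mem_distSet x z, hz⟩
    exact hX.dist_eq_abs_sub_of_abs_sub_mem hy hz hsub.1 hs ▸ hsub.2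

theorem exists_isometryEquiv_addSubgroup (hX : IsBanakh X) {x : X} {r : ℝ}
    (h : ∀ y ∈ setSphere x (ratMultiples r), ∀ z ∈ setSphere x (ratMultiples r),
      dist y z ∈ ratMultiples r) :
    ∃ H : AddSubgroup ℝ, (H : Set ℝ) ⊆ ratMultiples r ∧
      Nonempty (setSphere x (ratMultiples r) ≃ᵢ H) := by
  obtain ⟨e, he, hex⟩ : ∃ e ∈ setSphere x (ratMultiples r),
      ∀ y ∈ setSphere x (ratMultiples r), y ≠ x → e ≠ x := by
    by_contra! hne
    obtain ⟨y, hy, hyx, -⟩ := hne x (self_mem_setSphere x r)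
    obtain ⟨-, -, -, hyx'⟩ := hne y hy
    exact hyx hyx'
  let f : setSphere x (ratMultiples r) → ℝ := fun y => signedDist x e y
  have hdist (y z : setSphere x (ratMultiples r)) : |f y - f z| = dist y z :=
    (hX.dist_eq_abs_signedDist_sub he y.2 z.2 (h y y.2 z z.2) (hex y y.2)).symm
  have hf : Isometry f := Isometry.of_dist_eq fun y z => hdist y z
  have hmem {t : ℝ} : t ∈ Set.range f ↔ |t| ∈ distSet X ∩ ratMultiples r := by
    constructor
    · rintro ⟨y, rfl⟩
      rw [abs_signedDist]
      exact ⟨dist_mem_distSet x y, y.2⟩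
    · intro ht
      obtain ⟨y, hy, rfl⟩ := hX.exists_signedDist_eq he ht hex
      exact ⟨⟨y, (hy ▸ ht.2 : dist x y ∈ ratMultiples r)⟩, rfl⟩
  let H : AddSubgroup ℝ := AddSubgroup.ofSub (Set.range f) ⟨f ⟨e, he⟩, Set.mem_range_self _⟩ <| by
    rintro _ ⟨y, rfl⟩ _ ⟨z, rfl⟩
    rw [← sub_eq_add_neg, hmem, hdist]
    exact ⟨dist_mem_distSet (y : X) z, h y y.2 z z.2⟩
  exact ⟨H, fun t ht => abs_mem_ratMultiples_iff.1 (hmem.1 ht).2,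
    nonempty_isometryEquiv_of_range_eq hf rfl⟩

theorem exists_dist_eq_abs_two_mul_sub (hX : IsBanakh X) {x y z : X} {r : ℝ}
    (h : IsCentrallySymmetric (setSphere x (ratMultiples r))) (hy : dist x y ∈ ratMultiples r)
    (hz : dist x z ∈ ratMultiples r) (hyx : y ≠ x) (hyz : ¬ Separates x y z) :
    ∃ w, dist x w ∈ ratMultiples r ∧ dist x w = |2 * dist x y - dist x z| := by
  have hx := self_mem_setSphere x r
  obtain ⟨f, hfy, hfx⟩ := h ⟨y, hy⟩ ⟨x, hx⟩ fun he => hyx (congrArg Subtype.val he)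
  have hf (p q : setSphere x (ratMultiples r)) : dist (f p : X) (f q) = dist (p : X) q :=
    f.dist_eq p q
  set u : X := (f ⟨x, hx⟩).1
  set w : X := (f ⟨z, hz⟩).1
  have hu : dist x u ∈ ratMultiples r := (f ⟨x, hx⟩).2
  have hw : dist x w ∈ ratMultiples r := (f ⟨z, hz⟩).2
  have hyu : dist y u = dist y x := by simpa only [hfy] using hf ⟨y, hy⟩ ⟨x, hx⟩
  have hyw : dist y w = dist y z := by simpa only [hfy] using hf ⟨y, hy⟩ ⟨z, hz⟩
  have huw : dist u w = dist x z := hf ⟨x, hx⟩ ⟨z, hz⟩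
  have hux : dist u x = 2 * dist x y := by
    rw [hX.dist_eq_two_mul hyu fun he => hfx (Subtype.ext he), hyu, dist_comm]
  have huxw : ¬ Separates u x w := by
    intro hs
    have hxw := dist_triangle x y w
    rw [hs, hux, huw, hyw] at hxw
    exact hyz (le_antisymm (dist_triangle_left y z x) (by linarith))
  refine ⟨w, hw, ?_⟩
  rw [← hux, ← huw]
  exact hX.dist_eq_abs_sub_of_not_separates (dist_comm x u ▸ hu) (huw ▸ hz) hw huxw

theorem abs_two_mul_sub_mem_distSet (hX : IsBanakh X) {x : X} {r s t : ℝ}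
    (h : IsCentrallySymmetric (setSphere x (ratMultiples r)))
    (hs : s ∈ distSet X ∩ ratMultiples r) (ht : t ∈ distSet X ∩ ratMultiples r) :
    |2 * s - t| ∈ distSet X ∩ ratMultiples r := by
  rcases eq_or_ne t 0 with rfl | ht0
  · rw [sub_zero, two_mul, abs_of_nonneg (add_nonneg (distSet_nonneg hs.1) (distSet_nonneg hs.1))]
    exact hX.add_mem_distSet hs hs
  rcases eq_or_ne s 0 with rfl | hs0
  · rwa [mul_zero, zero_sub, abs_neg, abs_of_nonneg (distSet_nonneg ht.1)]
  obtain ⟨y, -, rfl, -, -⟩ := hX.exists_dist_eq x hs.1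
  have hyx : y ≠ x := (dist_ne_zero.1 hs0).symm
  obtain ⟨z, rfl, hyz⟩ := hX.exists_not_separates hyx ht.1 ht0
  obtain ⟨w, hw, hxw⟩ := hX.exists_dist_eq_abs_two_mul_sub h hs.2 ht.2 hyx hyz
  exact hxw ▸ ⟨dist_mem_distSet x w, hw⟩

theorem isHalfGroup_of_isCentrallySymmetric (hX : IsBanakh X) {x : X} {r : ℝ}
    (h : IsCentrallySymmetric (setSphere x (ratMultiples r))) :
    IsHalfGroup (distSet X ∩ ratMultiples r) :=
  isHalfGroup_of_abs_two_mul_sub_mem (fun _ ht => distSet_nonneg ht.1) Set.inter_subset_right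
    ⟨zero_mem_distSet x, zero_mem_ratMultiples r⟩
    (fun _ hs _ ht => hX.add_mem_distSet hs ht)
    (fun _ hs _ ht => hX.abs_two_mul_sub_mem_distSet h hs ht)

end IsBanakh

section Rat

theorem exists_rat_isometryEquiv_of_subset_range {Y : Type*} [MetricSpace Y] {H : AddSubgroup ℝ}
    (hH : (H : Set ℝ) ⊆ Set.range ((↑) : ℚ → ℝ)) (g : Y ≃ᵢ H) :
    ∃ G : AddSubgroup ℚ, Nonempty (Y ≃ᵢ G) := by
  choose p hp using fun y => hH (g y).2
  have hp_isom : Isometry p := Isometry.of_dist_eq fun y z => by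
    rw [← Rat.dist_cast, hp, hp, ← Subtype.dist_eq, g.dist_eq]
  refine ⟨H.comap ((Rat.castHom ℝ).toAddMonoidHom), nonempty_isometryEquiv_of_range_eq hp_isom ?_⟩
  ext q
  constructor
  · rintro ⟨y, rfl⟩
    simp [hp]
  · intro hq
    refine ⟨g.symm ⟨q, hq⟩, Rat.cast_injective (α := ℝ) ?_⟩
    rw [hp, g.apply_symm_apply]

end Rat

theorem IsBanakh.exists_isometryEquiv_addSubgroup_rat {X : Type*} [MetricSpace X] [Nonempty X]
    (hX : IsBanakh X) (hQ : distSet X ⊆ Set.range ((↑) : ℚ → ℝ)) :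
    ∃ G : AddSubgroup ℚ, Nonempty (X ≃ᵢ G) := by
  obtain ⟨x⟩ := ‹Nonempty X›
  have hall (y z : X) : dist y z ∈ ratMultiples 1 :=
    mem_ratMultiples_one.2 (hQ (dist_mem_distSet y z))
  obtain ⟨H, hH, ⟨g⟩⟩ := hX.exists_isometryEquiv_addSubgroup (x := x) fun y _ z _ => hall y z
  let i : X ≃ᵢ setSphere x (ratMultiples 1) :=
    ⟨(Equiv.subtypeUnivEquiv fun y => hall x y).symm, fun _ _ => rfl⟩
  exact exists_rat_isometryEquiv_of_subset_range (fun t ht => mem_ratMultiples_one.1 (hH ht))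
    (i.trans g)

end BanakhSpace

theorem theoremt_general {X : Type*} [MetricSpace X] (hX : BanakhSpace.IsBanakh X) :
    (∀ x : X, ∀ r : ℝ,
      List.TFAE [
        ∃ A : Set ℝ,
          Nonempty (BanakhSpace.setSphere x (BanakhSpace.ratMultiples r) ≃ᵢ A),
        ∃ H : AddSubgroup ℝ, (H : Set ℝ) ⊆ BanakhSpace.ratMultiples r ∧
          Nonempty (BanakhSpace.setSphere x (BanakhSpace.ratMultiples r) ≃ᵢ H),
        ∀ y ∈ BanakhSpace.setSphere x (BanakhSpace.ratMultiples r),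
          ∀ z ∈ BanakhSpace.setSphere x (BanakhSpace.ratMultiples r),
            dist y z ∈ BanakhSpace.ratMultiples r,
        BanakhSpace.IsCentrallySymmetric
          (BanakhSpace.setSphere x (BanakhSpace.ratMultiples r)),
        BanakhSpace.IsHalfGroup
          (BanakhSpace.distSet X ∩ BanakhSpace.ratMultiples r)]) ∧
    (Nonempty X → BanakhSpace.distSet X ⊆ Set.range ((↑) : ℚ → ℝ) →
      ∃ G : AddSubgroup ℚ, Nonempty (X ≃ᵢ G)) := by
  refine ⟨fun x r => ?_, fun _ hQ => hX.exists_isometryEquiv_addSubgroup_rat hQ⟩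
  tfae_have 5 → 3 := fun h _ hy _ hz => hX.dist_mem_ratMultiples_of_isHalfGroup h hy hz
  tfae_have 3 → 2 := hX.exists_isometryEquiv_addSubgroup
  tfae_have 2 → 1 := fun ⟨H, _, hg⟩ => ⟨H, hg⟩
  tfae_have 1 → 3 := fun ⟨_, ⟨g⟩⟩ y hy z hz =>
    BanakhSpace.dist_mem_ratMultiples_of_isometry (isometry_subtype_coe.comp g.isometry)
      (c := ⟨x, BanakhSpace.self_mem_setSphere x r⟩) (y := ⟨y, hy⟩) (z := ⟨z, hz⟩) hy hz
  tfae_have 2 → 4 := fun ⟨_, _, ⟨g⟩⟩ => BanakhSpace.isCentrallySymmetric_of_isometryEquiv g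
  tfae_have 4 → 5 := hX.isHalfGroup_of_isCentrallySymmetric
  tfae_finish

theorem theoremt {X : Type*} [MetricSpace X] (hX : BanakhSpace.IsBanakh X) :
    (∀ x : X, ∀ r ∈ BanakhSpace.distSet X,
      List.TFAE [
        ∃ A : Set ℝ,
          Nonempty (BanakhSpace.setSphere x (BanakhSpace.ratMultiples r) ≃ᵢ A),
        ∃ H : AddSubgroup ℝ, (H : Set ℝ) ⊆ BanakhSpace.ratMultiples r ∧
          Nonempty (BanakhSpace.setSphere x (BanakhSpace.ratMultiples r) ≃ᵢ H),
        ∀ y ∈ BanakhSpace.setSphere x (BanakhSpace.ratMultiples r),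
          ∀ z ∈ BanakhSpace.setSphere x (BanakhSpace.ratMultiples r),
            dist y z ∈ BanakhSpace.ratMultiples r,
        BanakhSpace.IsCentrallySymmetric
          (BanakhSpace.setSphere x (BanakhSpace.ratMultiples r)),
        BanakhSpace.IsHalfGroup
          (BanakhSpace.distSet X ∩ BanakhSpace.ratMultiples r)]) ∧
    (Nonempty X → BanakhSpace.distSet X ⊆ Set.range ((↑) : ℚ → ℝ) →
      ∃ G : AddSubgroup ℚ, Nonempty (X ≃ᵢ G)) :=
  ⟨fun x r _ => (theoremt_general hX).1 x r, (theoremt_general hX).2⟩
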